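/- Write points of Minkowski spacetime $\mathbb{R}^4$ as $x = (t,\vec{x})$ with $t \in \mathbb{R}$, $\vec{x} \in \mathbb{R}^3$, and let $x^2 = -t^2 + |\vec{x}|^2$. Let $f \in C_0^\infty(\mathbb{R}^4)$ be a smooth, compactly supported, complex-valued (in particular, possibly real-valued) function with vanishing mean, $\int f(x) \, \mathrm{d}^4 x = 0$. For $\vec{p} \in \mathbb{R}^3 \setminus \{0\}$ put $$G_f(\vec{p}) = \iint f(x) f(x') \, \frac{1}{4 |\vec{p}|^3} \, \mathrm{e}^{-\mathrm{i} |\vec{p}| (t-t')} \bigl[ 1 + \mathrm{i} |\vec{p}| (t-t') \bigr] \, \mathrm{e}^{\mathrm{i} \vec{p} \cdot (\vec{x}-\vec{x}')} \, \mathrm{d}^4 x \, \mathrm{d}^4 x' .$$ Then $G_f$ is Lebesgue integrable on $\mathbb{R}^3$, the function $(x,x') \mapsto f(x) f(x') \ln|(x-x')^2|$ is Lebesgue integrable on $\mathbb{R}^4 \times \mathbb{R}^4$, and $$\int_{\mathbb{R}^3} G_f(\vec{p}) \, \frac{\mathrm{d}^3 \vec{p}}{(2\pi)^3} = - \frac{1}{16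 \pi^2} \iint f(x) f(x') \ln\bigl| (x-x')^2 \bigr| \, \mathrm{d}^4 x \, \mathrm{d}^4 x' .$$ The left-hand side is the pairing of $f \otimes f$ with the inverse spatial Fourier transform, in the sense of distributions, of the kernel $\frac{1}{4|\vec{p}|^3} \mathrm{e}^{-\mathrm{i}|\vec{p}|(t-t')} [1 + \mathrm{i}|\vec{p}|(t-t')]$. -/

import Mathlib

/-- Minkowski spacetime `ℝ⁴` with Cartesian coordinates `x = (t, 𝐱)`: the time `x.1 = t` and the
Euclidean space vector `x.2 = 𝐱 ∈ ℝ³`. Its `volume` is the Lebesgue measure `dt d³𝐱`. -/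
abbrev Spacetime : Type := ℝ × EuclideanSpace ℝ (Fin 3)

/-- The Minkowski square `x² = -t² + |𝐱|²`. -/
noncomputable def minkowskiSq (x : Spacetime) : ℝ := -x.1 ^ 2 + ‖x.2‖ ^ 2

/-- The momentum-space kernel
`F(t, t', p) = (1 / (4 |p|³)) exp(-i |p| (t - t')) (1 + i |p| (t - t'))`. -/
noncomputable def momentumKernel (t t' : ℝ) (p : EuclideanSpace ℝ (Fin 3)) : ℂ :=
  1 / (4 * (‖p‖ : ℂ) ^ 3) * Complex.exp (-Complex.I * ‖p‖ * (t - t')) *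
    (1 + Complex.I * ‖p‖ * (t - t'))

/-- The kernel `F(t, t', p) exp(i p · (𝐱 - 𝐱'))`, at fixed momentum `p`, tested against `f ⊗ f`.
The inverse spatial Fourier transform of `F` is a distribution; its pairing with `f ⊗ f` is
the integral of `smearedKernel f p` against `d³p / (2π)³`. -/
noncomputable def smearedKernel (f : Spacetime → ℂ) (p : EuclideanSpace ℝ (Fin 3)) : ℂ :=
  ∫ x : Spacetime, ∫ x' : Spacetime,
    f x * f x' *
      (momentumKernel x.1 x'.1 p * Complex.exp (Complex.I * (inner ℝ p (x.2 - x'.2) : ℝ)))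

/-! Replace `i (t - t')` by a complex number `s` with `Re s > 0`, so that the kernel becomes
`K_s(|𝐩|) e^{i 𝐩·𝐱}` with `K_s(q) = e^{-sq} (1 + sq) / (4 q³)`. Since `f ⊗ f` has mean zero, the
infrared-divergent constant `K_1(|𝐩|)` may be subtracted. As `-e^{-sq} / (4q)` is a primitive of
`q K_s(q)`, integrating over the planes orthogonal to `𝐱` leaves
`(π/2) ∫ (e^{-s|k| + ik|𝐱|} - e^{-|k|}) / |k| dk`, a Frullani integral equal to
`-(π/2) (log (s - i|𝐱|) + log (s + i|𝐱|))`.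

At `s = ε + i (t - t')`, exchanging the two points conjugates these logarithms, so only their real
part survives against the symmetric `f ⊗ f`, and it tends to `log |(x - x')²|` as `ε → 0`. In
momentum space the limit is dominated: integrating out the space-time points leaves products of
values of the Fourier transforms of `f` and `t f` on the light cone, and the former is
`O(|𝐩| / (1 + |𝐩|²))` because `f` has mean zero and is differentiable.
-/

open MeasureTheory Set Filter Topology Module ComplexConjugate

section ExponentialIntegrals

lemma norm_cexp_sub_cexp_le_of_re_le {z w : ℂ} {m : ℝ} (hz : z.re ≤ m) (hw : w.re ≤ m) :
    ‖Complex.exp z - Complex.exp w‖ ≤ Real.exp m * ‖z - w‖ := by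
  refine Convex.norm_image_sub_le_of_norm_deriv_le (𝕜 := ℂ) (s := {u : ℂ | u.re ≤ m})
    (fun _ _ => Complex.differentiableAt_exp) (fun u hu => ?_) (convex_halfSpace_re_le m) hw hz
  rw [Complex.deriv_exp, Complex.norm_exp]
  exact Real.exp_le_exp.2 hu

lemma norm_one_add_mul_cexp_sub_one_add_mul_cexp_le {z w : ℂ} {m : ℝ} (u v : ℂ) (hz : z.re ≤ m)
    (hw : w.re ≤ m) :
    ‖(1 + u) * Complex.exp z - (1 + v) * Complex.exp w‖
      ≤ Real.exp m * (‖z - w‖ + ‖u‖ + ‖v‖) := by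
  have hexp {x : ℂ} (hx : x.re ≤ m) : ‖Complex.exp x‖ ≤ Real.exp m := by
    rw [Complex.norm_exp]
    exact Real.exp_le_exp.2 hx
  calc ‖(1 + u) * Complex.exp z - (1 + v) * Complex.exp w‖
      = ‖(Complex.exp z - Complex.exp w) + u * Complex.exp z - v * Complex.exp w‖ := by ring_nf
    _ ≤ ‖Complex.exp z - Complex.exp w‖ + ‖u * Complex.exp z‖ + ‖v * Complex.exp w‖ :=
        (norm_sub_le _ _).trans (by gcongr; exact norm_add_le _ _)
    _ ≤ Real.exp m * ‖z - w‖ + ‖u‖ * Real.exp m + ‖v‖ * Real.exp m := by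
        rw [norm_mul, norm_mul]
        gcongr
        exacts [norm_cexp_sub_cexp_le_of_re_le hz hw, hexp hz, hexp hw]
    _ = Real.exp m * (‖z - w‖ + ‖u‖ + ‖v‖) := by ring

lemma norm_cexp_neg_mul_sub_cexp_neg_mul_div_le {a b : ℂ} {δ : ℝ} (ha : δ ≤ a.re)
    (hb : δ ≤ b.re) {k : ℝ} (hk : 0 < k) :
    ‖(Complex.exp (-(a * k)) - Complex.exp (-(b * k))) / k‖ ≤ ‖a - b‖ * Real.exp (-δ * k) := by
  have hre {c : ℂ} (hc : δ ≤ c.re) : (-(c * k)).re ≤ -δ * k := by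
    rw [Complex.neg_re, Complex.re_mul_ofReal]
    nlinarith
  rw [norm_div, Complex.norm_real, Real.norm_of_nonneg hk.le, div_le_iff₀ hk]
  calc ‖Complex.exp (-(a * k)) - Complex.exp (-(b * k))‖
      ≤ Real.exp (-δ * k) * ‖-(a * (k : ℂ)) - -(b * k)‖ :=
        norm_cexp_sub_cexp_le_of_re_le (hre ha) (hre hb)
    _ = Real.exp (-δ * k) * (‖a - b‖ * k) := by
        rw [show -(a * (k : ℂ)) - -(b * k) = -((a - b) * k) by ring, norm_neg, norm_mul,
          Complex.norm_real, Real.norm_of_nonneg hk.le]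
    _ = ‖a - b‖ * Real.exp (-δ * k) * k := by ring

lemma integrableOn_cexp_neg_mul_sub_cexp_neg_mul_div {a b : ℂ} (ha : 0 < a.re) (hb : 0 < b.re) :
    IntegrableOn (fun k : ℝ => (Complex.exp (-(a * k)) - Complex.exp (-(b * k))) / k)
      (Ioi 0) := by
  have hexp := integrableOn_exp_mul_Ioi (neg_lt_zero.2 (lt_min ha hb)) 0
  refine (hexp.const_mul ‖a - b‖).mono' (Measurable.aestronglyMeasurable (by fun_prop)) ?_
  filter_upwards [self_mem_ae_restrict measurableSet_Ioi] with k hk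
  exact norm_cexp_neg_mul_sub_cexp_neg_mul_div_le (min_le_left _ _) (min_le_right _ _) hk

lemma min_re_one_le_re_one_add_smul (a : ℂ) {u : ℝ} (hu : u ∈ Icc (0 : ℝ) 1) :
    min a.re 1 ≤ (1 + u • (a - 1)).re := by
  have hre : (1 + u • (a - 1)).re = (1 - u) * 1 + u * a.re := by
    simp only [Complex.add_re, Complex.one_re, Complex.real_smul, Complex.re_ofReal_mul,
      Complex.sub_re]
    ring
  rw [hre]
  nlinarith [mul_le_mul_of_nonneg_left (min_le_left a.re 1) hu.1,
    mul_le_mul_of_nonneg_left (min_le_right a.re 1) (sub_nonneg.2 hu.2)]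

lemma cexp_neg_mul_sub_cexp_neg_div_eq_integral (a : ℂ) {k : ℝ} (hk : k ≠ 0) :
    (Complex.exp (-(a * k)) - Complex.exp (-k)) / k
      = ∫ u in Ioc (0 : ℝ) 1, -(a - 1) * Complex.exp (-(1 + u • (a - 1)) * k) := by
  have hk' : (k : ℂ) ≠ 0 := by exact_mod_cast hk
  have hderiv (u : ℝ) : HasDerivAt (fun u : ℝ => Complex.exp (-(1 + u • (a - 1)) * k) / k)
      (-(a - 1) * Complex.exp (-(1 + u • (a - 1)) * k)) u := by
    have hline := (((hasDerivAt_id u).smul_const (a - 1)).const_add 1).neg.mul_const (k : ℂ)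
    refine (hline.cexp.div_const (k : ℂ)).congr_deriv ?_
    simp only [id_eq, one_smul, Pi.neg_apply]
    field_simp
  rw [← intervalIntegral.integral_of_le zero_le_one,
    intervalIntegral.integral_eq_sub_of_hasDerivAt (fun u _ => hderiv u)
      (Continuous.intervalIntegrable (by fun_prop) _ _)]
  simp [sub_div]

lemma integrable_cexp_neg_one_add_smul_mul {a : ℂ} (ha : 0 < a.re) :
    Integrable (fun z : ℝ × ℝ => Complex.exp (-(1 + z.2 • (a - 1)) * z.1))
      ((volume.restrict (Ioi 0)).prod (volume.restrict (Ioc 0 1))) := by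
  have hexp := integrableOn_exp_mul_Ioi (neg_lt_zero.2 (lt_min ha one_pos)) 0
  have hdom := hexp.mul_prod (integrable_const (μ := volume.restrict (Ioc (0 : ℝ) 1)) (1 : ℝ))
  refine hdom.mono' (Continuous.aestronglyMeasurable (by fun_prop)) ?_
  rw [Measure.prod_restrict]
  filter_upwards [self_mem_ae_restrict (measurableSet_Ioi.prod measurableSet_Ioc)] with z hz
  rw [Complex.norm_exp, mul_one, Complex.re_mul_ofReal, Complex.neg_re]
  have hz₁ : 0 < z.1 := hz.1
  gcongr
  exact min_re_one_le_re_one_add_smul a (Ioc_subset_Icc_self hz.2)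

lemma integral_Ioi_cexp_neg_mul_sub_cexp_neg_div {a : ℂ} (ha : 0 < a.re) :
    ∫ k in Ioi (0 : ℝ), (Complex.exp (-(a * k)) - Complex.exp (-k)) / k = -Complex.log a := by
  have hpos : 0 < min a.re 1 := lt_min ha one_pos
  have hinner : ∀ u ∈ Ioc (0 : ℝ) 1,
      ∫ k in Ioi (0 : ℝ), Complex.exp (-(1 + u • (a - 1)) * k) = (1 + u • (a - 1))⁻¹ := by
    intro u hu
    have hre := hpos.trans_le (min_re_one_le_re_one_add_smul a (Ioc_subset_Icc_self hu))
    rw [integral_exp_mul_complex_Ioi (by rw [Complex.neg_re]; linarith)]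
    simp only [Complex.ofReal_zero, mul_zero, Complex.exp_zero, neg_div_neg_eq, one_div]
  have hslit : 1 + (a - 1) ∈ Complex.slitPlane := by
    rw [add_sub_cancel]
    exact Or.inl ha
  -- Integrate the derivative of the exponential along the segment from `1` to `a`.
  calc ∫ k in Ioi (0 : ℝ), (Complex.exp (-(a * k)) - Complex.exp (-k)) / k
      = ∫ k in Ioi (0 : ℝ), ∫ u in Ioc (0 : ℝ) 1,
          -(a - 1) * Complex.exp (-(1 + u • (a - 1)) * k) :=
        setIntegral_congr_fun measurableSet_Ioi fun k hk =>
          cexp_neg_mul_sub_cexp_neg_div_eq_integral a hk.ne'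
    _ = ∫ u in Ioc (0 : ℝ) 1, ∫ k in Ioi (0 : ℝ),
          -(a - 1) * Complex.exp (-(1 + u • (a - 1)) * k) :=
        integral_integral_swap ((integrable_cexp_neg_one_add_smul_mul ha).const_mul (-(a - 1)))
    _ = ∫ u in Ioc (0 : ℝ) 1, -(a - 1) * (1 + u • (a - 1))⁻¹ :=
        setIntegral_congr_fun measurableSet_Ioc fun u hu => by
          simp only [integral_const_mul, hinner u hu]
    _ = -((a - 1) * ∫ u in (0 : ℝ)..1, (1 + u • (a - 1))⁻¹) := by
        rw [integral_const_mul, intervalIntegral.integral_of_le zero_le_one, neg_mul]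
    _ = -Complex.log a := by rw [← Complex.log_eq_integral hslit, add_sub_cancel]

lemma integral_eq_integral_Ioi_comp_neg_add {E : Type*} [NormedAddCommGroup E] [NormedSpace ℝ E]
    {F : ℝ → E} (hneg : IntegrableOn (fun x => F (-x)) (Ioi 0)) (hpos : IntegrableOn F (Ioi 0)) :
    ∫ x, F x = (∫ x in Ioi 0, F (-x)) + ∫ x in Ioi 0, F x := by
  have hIci : IntegrableOn (fun x => F (-x)) (Ici (-0)) := by
    rwa [neg_zero, integrableOn_Ici_iff_integrableOn_Ioi]
  have hIic : IntegrableOn F (Iic 0) := by simpa only [neg_neg] using hIci.comp_neg_Iic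
  rw [integral_comp_neg_Ioi, neg_zero, intervalIntegral.integral_Iic_add_Ioi hIic hpos]

lemma integral_cexp_neg_mul_abs_mul_cexp_sub_div_abs {s : ℂ} (hs : 0 < s.re) (r : ℝ) :
    ∫ k : ℝ, (Complex.exp (-(s * |k|)) / |k| * Complex.exp (Complex.I * (k * r : ℝ))
        - Complex.exp (-|k|) / |k|)
      = -(Complex.log (s - Complex.I * r) + Complex.log (s + Complex.I * r)) := by
  have hsub : 0 < (s - Complex.I * r).re := by simpa using hs
  have hadd : 0 < (s + Complex.I * r).re := by simpa using hs
  have hmerge (c : ℂ) (k : ℝ) : Complex.exp (-(s * k)) / k * Complex.exp (c * k)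
      - Complex.exp (-k) / k = (Complex.exp (-((s - c) * k)) - Complex.exp (-k)) / k := by
    rw [show -((s - c) * (k : ℂ)) = -(s * k) + c * k by ring, Complex.exp_add]
    ring
  have hIoi : EqOn (fun k : ℝ => Complex.exp (-(s * |k|)) / |k| *
      Complex.exp (Complex.I * (k * r : ℝ)) - Complex.exp (-|k|) / |k|)
      (fun k => (Complex.exp (-((s - Complex.I * r) * k)) - Complex.exp (-k)) / k) (Ioi 0) := by
    intro k hk
    simp only [abs_of_pos (mem_Ioi.1 hk), ← hmerge]
    push_cast
    ring_nf
  have hneg : EqOn (fun k : ℝ => Complex.exp (-(s * |(-k)|)) / |(-k)| *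
      Complex.exp (Complex.I * (-k * r : ℝ)) - Complex.exp (-|(-k)|) / |(-k)|)
      (fun k => (Complex.exp (-((s + Complex.I * r) * k)) - Complex.exp (-k)) / k) (Ioi 0) := by
    intro k hk
    simp only [abs_neg, abs_of_pos (mem_Ioi.1 hk), ← sub_neg_eq_add s, ← hmerge]
    push_cast
    ring_nf
  have hint {a : ℂ} (ha : 0 < a.re) :
      IntegrableOn (fun k : ℝ => (Complex.exp (-(a * k)) - Complex.exp (-k)) / k) (Ioi 0) := by
    simpa only [one_mul] using integrableOn_cexp_neg_mul_sub_cexp_neg_mul_div ha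
      (b := 1) (by simp)
  rw [integral_eq_integral_Ioi_comp_neg_add ((hint hadd).congr_fun hneg.symm measurableSet_Ioi)
      ((hint hsub).congr_fun hIoi.symm measurableSet_Ioi),
    setIntegral_congr_fun measurableSet_Ioi hneg, setIntegral_congr_fun measurableSet_Ioi hIoi,
    integral_Ioi_cexp_neg_mul_sub_cexp_neg_div hadd,
    integral_Ioi_cexp_neg_mul_sub_cexp_neg_div hsub]
  ring

end ExponentialIntegrals

section MasslessKernel

/-- The massless kernel `e^{-sq} (1 + sq) / (4q³)` as a function of the radial momentum `q`, at
complex time `s`; `momentumKernel t t' p` is its value at `s = i (t - t')` and `q = |p|`. -/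
noncomputable def masslessKernel (s : ℂ) (q : ℝ) : ℂ :=
  Complex.exp (-(s * q)) * (1 + s * q) / (4 * q ^ 3)

@[fun_prop]
lemma measurable_masslessKernel (s : ℂ) : Measurable (masslessKernel s) := by
  unfold masslessKernel
  fun_prop

lemma norm_masslessKernel_le {s : ℂ} (hs : 0 < s.re) {q : ℝ} (hq : 0 < q) :
    ‖masslessKernel s q‖ ≤ (1 + ‖s‖ / s.re) / (4 * q ^ 3) := by
  have hnum : ‖Complex.exp (-(s * q))‖ * ‖1 + s * q‖ ≤ 1 + ‖s‖ / s.re := by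
    have hexp := Real.add_one_le_exp (s.re * q)
    have hsq : 0 < s.re * q := mul_pos hs hq
    rw [Complex.norm_exp, Complex.neg_re, Complex.re_mul_ofReal, Real.exp_neg,
      inv_mul_le_iff₀ (Real.exp_pos _)]
    calc ‖1 + s * q‖ ≤ 1 + ‖s‖ * q := by
          refine (norm_add_le _ _).trans_eq ?_
          rw [norm_one, norm_mul, Complex.norm_real, Real.norm_of_nonneg hq.le]
      _ = 1 + ‖s‖ / s.re * (s.re * q) := by field_simp
      _ ≤ Real.exp (s.re * q) + ‖s‖ / s.re * Real.exp (s.re * q) := by gcongr <;> linarith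
      _ = Real.exp (s.re * q) * (1 + ‖s‖ / s.re) := by ring
  have hden : ‖(4 * (q : ℂ) ^ 3)‖ = 4 * q ^ 3 := by
    rw [norm_mul, norm_pow, Complex.norm_real, Real.norm_of_nonneg hq.le, Complex.norm_ofNat]
  rw [masslessKernel, norm_div, norm_mul, hden]
  gcongr

lemma hasDerivAt_neg_cexp_neg_mul_div (s : ℂ) {q : ℝ} (hq : q ≠ 0) :
    HasDerivAt (fun q : ℝ => -(Complex.exp (-(s * q)) / (4 * q))) (q * masslessKernel s q) q := by
  have hq' : (q : ℂ) ≠ 0 := by exact_mod_cast hq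
  have hid : HasDerivAt (fun q : ℝ => (q : ℂ)) 1 q := Complex.ofRealCLM.hasDerivAt
  refine (((hid.const_mul s).neg.cexp.div (hid.const_mul 4) (by simpa using hq)).neg).congr_deriv ?_
  simp only [masslessKernel, Pi.neg_apply]
  field_simp
  ring

lemma hasDerivAt_sqrt_sq_add_sq {k : ℝ} (hk : k ≠ 0) (x : ℝ) :
    HasDerivAt (fun x : ℝ => √(k ^ 2 + x ^ 2)) (x / √(k ^ 2 + x ^ 2)) x := by
  have h := ((hasDerivAt_pow 2 x).const_add (k ^ 2)).sqrt (by positivity)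
  exact h.congr_deriv (by field_simp; norm_num)

lemma tendsto_sqrt_sq_add_sq_atTop (k : ℝ) :
    Tendsto (fun x : ℝ => √(k ^ 2 + x ^ 2)) atTop atTop :=
  Real.tendsto_sqrt_atTop.comp
    (tendsto_atTop_add_const_left _ _ (tendsto_pow_atTop two_ne_zero))

lemma tendsto_cexp_neg_mul_div_atTop {s : ℂ} (hs : 0 ≤ s.re) :
    Tendsto (fun q : ℝ => Complex.exp (-(s * q)) / (4 * q)) atTop (𝓝 0) := by
  refine squeeze_zero_norm' ?_ tendsto_inv_atTop_zero
  filter_upwards [eventually_gt_atTop 0] with q hq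
  rw [norm_div, Complex.norm_exp, Complex.neg_re, Complex.re_mul_ofReal, norm_mul,
    Complex.norm_real, Real.norm_of_nonneg hq.le, Complex.norm_ofNat, ← one_div]
  gcongr
  · exact Real.exp_le_one_iff.2 (by nlinarith)
  · linarith

lemma integrable_inv_sq_add_sq {k : ℝ} (hk : k ≠ 0) :
    Integrable (fun x : ℝ => (k ^ 2 + x ^ 2)⁻¹) := by
  have h := (integrable_inv_one_add_sq.comp_div hk).const_mul (k ^ 2)⁻¹
  refine h.congr (Eventually.of_forall fun x => ?_)
  field_simp

lemma integrableOn_mul_masslessKernel_sqrt {s : ℂ} (hs : 0 < s.re) {k : ℝ} (hk : k ≠ 0) :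
    IntegrableOn (fun x : ℝ => (x : ℂ) * masslessKernel s (√(k ^ 2 + x ^ 2))) (Ioi 0) := by
  refine ((integrable_inv_sq_add_sq hk).integrableOn.const_mul ((1 + ‖s‖ / s.re) / 4)).mono'
    (Measurable.aestronglyMeasurable (by fun_prop)) ?_
  filter_upwards [self_mem_ae_restrict measurableSet_Ioi] with x (hx : 0 < x)
  have hq : 0 < √(k ^ 2 + x ^ 2) := by positivity
  have hxq : x ≤ √(k ^ 2 + x ^ 2) := Real.le_sqrt_of_sq_le (by linarith [sq_nonneg k])
  have hsq : √(k ^ 2 + x ^ 2) ^ 2 = k ^ 2 + x ^ 2 := Real.sq_sqrt (by positivity)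
  rw [norm_mul, Complex.norm_real, Real.norm_of_nonneg hx.le]
  calc x * ‖masslessKernel s (√(k ^ 2 + x ^ 2))‖
      ≤ √(k ^ 2 + x ^ 2) * ((1 + ‖s‖ / s.re) / (4 * √(k ^ 2 + x ^ 2) ^ 3)) := by
        gcongr
        exact norm_masslessKernel_le hs hq
    _ = (1 + ‖s‖ / s.re) / 4 * (k ^ 2 + x ^ 2)⁻¹ := by
        nth_rewrite 3 [← hsq]
        field_simp

lemma integral_Ioi_mul_masslessKernel_sqrt {s : ℂ} (hs : 0 < s.re) {k : ℝ} (hk : k ≠ 0) :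
    ∫ x in Ioi (0 : ℝ), (x : ℂ) * masslessKernel s (√(k ^ 2 + x ^ 2))
      = Complex.exp (-(s * |k|)) / (4 * |k|) := by
  have hderiv (x : ℝ) : HasDerivAt
      (fun x : ℝ => -(Complex.exp (-(s * (√(k ^ 2 + x ^ 2) : ℝ))) / (4 * (√(k ^ 2 + x ^ 2) : ℝ))))
      (x * masslessKernel s (√(k ^ 2 + x ^ 2))) x := by
    have hq : √(k ^ 2 + x ^ 2) ≠ 0 := by positivity
    refine ((hasDerivAt_neg_cexp_neg_mul_div s hq).scomp x
      (hasDerivAt_sqrt_sq_add_sq hk x)).congr_deriv ?_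
    rw [← Complex.coe_smul, smul_eq_mul, ← mul_assoc, ← Complex.ofReal_mul, div_mul_cancel₀ _ hq]
  have hlim := ((tendsto_cexp_neg_mul_div_atTop hs.le).comp (tendsto_sqrt_sq_add_sq_atTop k)).neg
  rw [neg_zero] at hlim
  rw [integral_Ioi_of_hasDerivAt_of_tendsto' (fun x _ => hderiv x)
    (integrableOn_mul_masslessKernel_sqrt hs hk) hlim]
  simp [Real.sqrt_sq_eq_abs]

section Plane

variable {V : Type*} [NormedAddCommGroup V] [InnerProductSpace ℝ V] [FiniteDimensional ℝ V]
  [MeasurableSpace V] [BorelSpace V]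

lemma integrable_masslessKernel_plane (hV : finrank ℝ V = 2) {s : ℂ} (hs : 0 < s.re) {k : ℝ}
    (hk : k ≠ 0) : Integrable (fun w : V => masslessKernel s (√(k ^ 2 + ‖w‖ ^ 2))) := by
  have : Nontrivial V := nontrivial_of_finrank_pos (R := ℝ) (by omega)
  rw [integrable_fun_norm_addHaar volume (f := fun x => masslessKernel s (√(k ^ 2 + x ^ 2))), hV]
  simpa using integrableOn_mul_masslessKernel_sqrt hs hk

lemma integral_masslessKernel_plane (hV : finrank ℝ V = 2) {s : ℂ} (hs : 0 < s.re) {k : ℝ}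
    (hk : k ≠ 0) :
    ∫ w : V, masslessKernel s (√(k ^ 2 + ‖w‖ ^ 2))
      = (Real.pi / 2 : ℂ) * (Complex.exp (-(s * |k|)) / |k|) := by
  have : Nontrivial V := nontrivial_of_finrank_pos (R := ℝ) (by omega)
  have hball : volume.real (Metric.ball (0 : V) 1) = Real.pi := by
    rw [Measure.real, InnerProductSpace.volume_ball_of_dim_even (k := 1) (by omega)]
    simp [Real.pi_pos.le]
  rw [integral_fun_norm_addHaar volume (fun x => masslessKernel s (√(k ^ 2 + x ^ 2))), hV, hball]
  simp only [Nat.add_one_sub_one, pow_one, Complex.real_smul,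
    integral_Ioi_mul_masslessKernel_sqrt hs hk, nsmul_eq_mul]
  push_cast
  ring

lemma integral_masslessKernel_plane_mul_sub (hV : finrank ℝ V = 2) {s : ℂ} (hs : 0 < s.re)
    {k : ℝ} (hk : k ≠ 0) (c : ℂ) :
    ∫ w : V, (masslessKernel s (√(k ^ 2 + ‖w‖ ^ 2)) * c - masslessKernel 1 (√(k ^ 2 + ‖w‖ ^ 2)))
      = (Real.pi / 2 : ℂ) *
        (Complex.exp (-(s * |k|)) / |k| * c - Complex.exp (-|k|) / |k|) := by
  rw [integral_sub ((integrable_masslessKernel_plane hV hs hk).mul_const c)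
    (integrable_masslessKernel_plane hV (by simp) hk), integral_mul_const,
    integral_masslessKernel_plane hV hs hk, integral_masslessKernel_plane hV (by simp) hk, one_mul]
  ring

end Plane

lemma norm_masslessKernel_mul_cexp_sub_le {s : ℂ} {δ q c r : ℝ} (hs : δ ≤ s.re) (hδ : δ ≤ 1)
    (hq : 0 < q) (hc : |c| ≤ q * r) :
    ‖masslessKernel s q * Complex.exp (Complex.I * c) - masslessKernel 1 q‖
      ≤ (2 * ‖s‖ + r + 2) / 4 * (Real.exp (-δ * q) / q ^ 2) := by
  have hq_norm : ‖(q : ℂ)‖ = q := by rw [Complex.norm_real, Real.norm_of_nonneg hq.le]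
  have hs_re : (-(s * q) + Complex.I * c).re ≤ -δ * q := by
    rw [Complex.add_re, Complex.neg_re, Complex.re_mul_ofReal, Complex.I_mul_re, Complex.ofReal_im]
    nlinarith
  have hone_re : (-q : ℂ).re ≤ -δ * q := by
    rw [Complex.neg_re, Complex.ofReal_re]
    nlinarith
  have hdist : ‖-(s * q) + Complex.I * c - -q‖ ≤ (‖s‖ + r + 1) * q := by
    calc ‖-(s * q) + Complex.I * c - -q‖ ≤ ‖-(s * q)‖ + ‖Complex.I * c‖ + ‖(q : ℂ)‖ := by
          rw [sub_neg_eq_add]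
          exact norm_add₃_le
      _ = ‖s‖ * q + |c| + q := by
          rw [norm_neg, norm_mul, norm_mul, hq_norm, Complex.norm_I, one_mul, Complex.norm_real,
            Real.norm_eq_abs]
      _ ≤ (‖s‖ + r + 1) * q := by linarith
  have hnum := norm_one_add_mul_cexp_sub_one_add_mul_cexp_le (s * q) q hs_re hone_re
  rw [norm_mul, hq_norm] at hnum
  have hsplit : masslessKernel s q * Complex.exp (Complex.I * c) - masslessKernel 1 q
      = ((1 + s * q) * Complex.exp (-(s * q) + Complex.I * c) - (1 + q) * Complex.exp (-q))
        / (4 * q ^ 3) := by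
    rw [Complex.exp_add, masslessKernel, masslessKernel]
    ring_nf
  rw [hsplit, norm_div, norm_mul, norm_pow, hq_norm, Complex.norm_ofNat,
    div_le_iff₀ (by positivity)]
  calc _ ≤ Real.exp (-δ * q) * ((‖s‖ + r + 1) * q + ‖s‖ * q + q) := hnum.trans (by gcongr)
    _ = (2 * ‖s‖ + r + 2) / 4 * (Real.exp (-δ * q) / q ^ 2) * (4 * q ^ 3) := by
        field_simp
        ring

lemma norm_masslessKernel_norm_mul_cexp_inner_sub_le {E : Type*} [NormedAddCommGroup E]
    [InnerProductSpace ℝ E] {s : ℂ} {δ : ℝ} (hs : δ ≤ s.re) (hδ : δ ≤ 1) (p y : E) :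
    ‖masslessKernel s ‖p‖ * Complex.exp (Complex.I * (inner ℝ p y : ℝ)) - masslessKernel 1 ‖p‖‖
      ≤ (2 * ‖s‖ + ‖y‖ + 2) / 4 * (Real.exp (-δ * ‖p‖) / ‖p‖ ^ 2) := by
  rcases eq_or_ne p 0 with rfl | hp
  · simp [masslessKernel]
  · exact norm_masslessKernel_mul_cexp_sub_le hs hδ (norm_pos_iff.2 hp) (abs_real_inner_le_norm p y)

end MasslessKernel

section AxisSplitting

variable {E F : Type*} [NormedAddCommGroup E] [InnerProductSpace ℝ E] [FiniteDimensional ℝ E]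
  [NormedAddCommGroup F] [InnerProductSpace ℝ F] [FiniteDimensional ℝ F]

lemma exists_linearIsometryEquiv_apply_eq (hEF : finrank ℝ E = finrank ℝ F) {x : E} {y : F}
    (hxy : ‖x‖ = ‖y‖) : ∃ R : E ≃ₗᵢ[ℝ] F, R x = y := by
  let φ : E ≃ₗᵢ[ℝ] F := (stdOrthonormalBasis ℝ E).equiv (stdOrthonormalBasis ℝ F) (finCongr hEF)
  refine ⟨φ.trans (ℝ ∙ (φ x - y))ᗮ.reflection, ?_⟩
  exact Submodule.reflection_sub ((φ.norm_map x).trans hxy)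

lemma exists_measurePreserving_prod_inner_eq [MeasurableSpace E] [BorelSpace E]
    [MeasurableSpace F] [BorelSpace F] (hEF : finrank ℝ E = finrank ℝ F + 1) (y : E) :
    ∃ e : E ≃ᵐ ℝ × F, MeasurePreserving e ∧
      ∀ p, inner ℝ p y = (e p).1 * ‖y‖ ∧ ‖p‖ = √((e p).1 ^ 2 + ‖(e p).2‖ ^ 2) := by
  have hdim : finrank ℝ E = finrank ℝ (WithLp 2 (ℝ × F)) := by
    rw [(WithLp.linearEquiv 2 ℝ (ℝ × F)).finrank_eq, finrank_prod, finrank_self, hEF, add_comm]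
  have hnorm : ‖y‖ = ‖WithLp.toLp 2 ((‖y‖, 0) : ℝ × F)‖ := by simp
  obtain ⟨R, hR⟩ := exists_linearIsometryEquiv_apply_eq hdim hnorm
  refine ⟨R.toHomeomorph.toMeasurableEquiv.trans (MeasurableEquiv.toLp 2 (ℝ × F)).symm,
    (WithLp.volume_preserving_ofLp ℝ F).comp R.measurePreserving, fun p => ⟨?_, ?_⟩⟩
  · rw [← R.inner_map_map, hR, WithLp.prod_inner_apply]
    simp [mul_comm]
  · rw [← R.norm_map, WithLp.prod_norm_eq_of_L2, Real.norm_eq_abs, sq_abs]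
    rfl

end AxisSplitting

section ThreeDimensional

variable {E : Type*} [NormedAddCommGroup E] [InnerProductSpace ℝ E] [FiniteDimensional ℝ E]
  [MeasurableSpace E] [BorelSpace E]

lemma integrable_div_norm_sq_of_finrank_eq_three (hE : finrank ℝ E = 3) {g : ℝ → ℝ}
    (hg : IntegrableOn g (Ioi 0)) : Integrable (fun p : E => g ‖p‖ / ‖p‖ ^ 2) := by
  have : Nontrivial E := nontrivial_of_finrank_pos (R := ℝ) (by omega)
  rw [integrable_fun_norm_addHaar volume (f := fun q => g q / q ^ 2), hE]
  refine hg.congr_fun (fun q (hq : 0 < q) => ?_) measurableSet_Ioi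
  simp only [Nat.add_one_sub_one, smul_eq_mul]
  field_simp

lemma integrable_masslessKernel_mul_cexp_inner_sub (hE : finrank ℝ E = 3) {s : ℂ}
    (hs : 0 < s.re) (y : E) :
    Integrable (fun p : E =>
      masslessKernel s ‖p‖ * Complex.exp (Complex.I * (inner ℝ p y : ℝ)) - masslessKernel 1 ‖p‖) :=
  have hexp := integrableOn_exp_mul_Ioi (neg_lt_zero.2 (lt_min hs one_pos)) 0
  ((integrable_div_norm_sq_of_finrank_eq_three hE hexp).const_mul ((2 * ‖s‖ + ‖y‖ + 2) / 4)).mono'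
    (Measurable.aestronglyMeasurable (by fun_prop)) (Eventually.of_forall fun p =>
      norm_masslessKernel_norm_mul_cexp_inner_sub_le (min_le_left _ _) (min_le_right _ _) p y)

lemma integral_masslessKernel_mul_cexp_inner_sub (hE : finrank ℝ E = 3) {s : ℂ} (hs : 0 < s.re)
    (y : E) :
    ∫ p : E, (masslessKernel s ‖p‖ * Complex.exp (Complex.I * (inner ℝ p y : ℝ))
        - masslessKernel 1 ‖p‖)
      = -(Real.pi / 2) *
        (Complex.log (s - Complex.I * ‖y‖) + Complex.log (s + Complex.I * ‖y‖)) := by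
  have hV : finrank ℝ (EuclideanSpace ℝ (Fin 2)) = 2 := finrank_euclideanSpace_fin
  obtain ⟨e, he, he_apply⟩ :=
    exists_measurePreserving_prod_inner_eq (F := EuclideanSpace ℝ (Fin 2)) (by rw [hE, hV]) y
  set H : ℝ × EuclideanSpace ℝ (Fin 2) → ℂ := fun z =>
    masslessKernel s (√(z.1 ^ 2 + ‖z.2‖ ^ 2)) * Complex.exp (Complex.I * (z.1 * ‖y‖ : ℝ))
      - masslessKernel 1 (√(z.1 ^ 2 + ‖z.2‖ ^ 2))
  have hcomp (p : E) : masslessKernel s ‖p‖ * Complex.exp (Complex.I * (inner ℝ p y : ℝ))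
      - masslessKernel 1 ‖p‖ = H (e p) := by
    rw [(he_apply p).1, (he_apply p).2]
  have hH_int : Integrable H := by
    rw [← he.integrable_comp_emb e.measurableEmbedding]
    exact (integrable_masslessKernel_mul_cexp_inner_sub hE hs y).congr
      (Eventually.of_forall hcomp)
  calc _ = ∫ p, H (e p) := integral_congr_ae (Eventually.of_forall hcomp)
    _ = ∫ k : ℝ, ∫ w, H (k, w) := by
        rw [he.integral_comp e.measurableEmbedding, Measure.volume_eq_prod, integral_prod _ hH_int]
    _ = ∫ k : ℝ, (Real.pi / 2 : ℂ) *
          (Complex.exp (-(s * |k|)) / |k| * Complex.exp (Complex.I * (k * ‖y‖ : ℝ))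
            - Complex.exp (-|k|) / |k|) :=
        integral_congr_ae (by
          filter_upwards [Measure.ae_ne volume 0] with k hk
          exact integral_masslessKernel_plane_mul_sub hV hs hk
            (Complex.exp (Complex.I * (k * ‖y‖ : ℝ))))
    _ = _ := by
        rw [integral_const_mul, integral_cexp_neg_mul_abs_mul_cexp_sub_div_abs hs]
        ring

end ThreeDimensional

section DualFourier

variable {X : Type*} [NormedAddCommGroup X] [NormedSpace ℝ X]

lemma fderiv_cexp_I_mul_apply (L : X →L[ℝ] ℝ) (x v : X) :
    fderiv ℝ (fun x => Complex.exp (Complex.I * (L x : ℝ))) x v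
      = Complex.exp (Complex.I * (L x : ℝ)) * (Complex.I * (L v : ℝ)) := by
  have h := ((Complex.ofRealCLM.comp L).hasFDerivAt (x := x)).const_mul Complex.I |>.cexp
  exact congrArg (· v) h.fderiv

variable [MeasurableSpace X]

/-- The Fourier transform `∫ g(x) e^{i L(x)} dx` as a function on the dual space, which spares the
choice of an inner product on spacetime. -/
noncomputable def dualFourier (μ : Measure X) (g : X → ℂ) (L : X →L[ℝ] ℝ) : ℂ :=
  ∫ x, g x * Complex.exp (Complex.I * (L x : ℝ)) ∂μ

variable [BorelSpace X] {μ : Measure X}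

lemma integrable_mul_cexp_I_mul {g : X → ℂ} (hg : Integrable g μ) (L : X →L[ℝ] ℝ) :
    Integrable (fun x => g x * Complex.exp (Complex.I * (L x : ℝ))) μ :=
  hg.mul_bdd (c := 1) (Continuous.aestronglyMeasurable (by fun_prop))
    (Eventually.of_forall fun x => (Complex.norm_exp_I_mul_ofReal (L x)).le)

lemma continuous_dualFourier {g : X → ℂ} (hg : Integrable g μ) :
    Continuous (dualFourier μ g) := by
  refine continuous_of_dominated (fun L => (integrable_mul_cexp_I_mul hg L).aestronglyMeasurable)
    (fun L => Eventually.of_forall fun x => ?_) hg.norm (Eventually.of_forall fun x => ?_)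
  · rw [norm_mul, Complex.norm_exp_I_mul_ofReal, mul_one]
  · fun_prop

lemma norm_dualFourier_le_of_integral_eq_zero {g : X → ℂ} (hg : Integrable g μ)
    (hg_norm : Integrable (fun x => ‖x‖ * ‖g x‖) μ) (hg_mean : ∫ x, g x ∂μ = 0)
    (L : X →L[ℝ] ℝ) : ‖dualFourier μ g L‖ ≤ ‖L‖ * ∫ x, ‖x‖ * ‖g x‖ ∂μ := by
  have hsub : dualFourier μ g L = ∫ x, g x * (Complex.exp (Complex.I * (L x : ℝ)) - 1) ∂μ := by
    simp_rw [mul_sub, mul_one]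
    rw [integral_sub (integrable_mul_cexp_I_mul hg L) hg, hg_mean, sub_zero, dualFourier]
  rw [hsub, ← integral_const_mul]
  refine norm_integral_le_of_norm_le (hg_norm.const_mul ‖L‖) (Eventually.of_forall fun x => ?_)
  calc ‖g x * (Complex.exp (Complex.I * (L x : ℝ)) - 1)‖ ≤ ‖g x‖ * (‖L‖ * ‖x‖) := by
        rw [norm_mul]
        gcongr
        exact Real.norm_exp_I_mul_ofReal_sub_one_le.trans (L.le_opNorm x)
    _ = ‖L‖ * (‖x‖ * ‖g x‖) := by ring

lemma abs_apply_mul_norm_dualFourier_le [FiniteDimensional ℝ X] [μ.IsAddHaarMeasure] {g : X → ℂ}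
    (hg : Differentiable ℝ g) (hg_int : Integrable g μ) {v : X}
    (hg_fderiv : Integrable (fun x => fderiv ℝ g x v) μ) (L : X →L[ℝ] ℝ) :
    |L v| * ‖dualFourier μ g L‖ ≤ ∫ x, ‖fderiv ℝ g x v‖ ∂μ := by
  have hg_phase := integrable_mul_cexp_I_mul hg_int L
  have hparts : dualFourier μ g L * (Complex.I * (L v : ℝ))
      = -dualFourier μ (fun x => fderiv ℝ g x v) L := by
    rw [dualFourier, dualFourier, ← integral_mul_const,
      ← integral_mul_fderiv_eq_neg_fderiv_mul_of_integrable
        (integrable_mul_cexp_I_mul hg_fderiv L)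
        (by simpa only [fderiv_cexp_I_mul_apply, ← mul_assoc] using
          hg_phase.mul_const (Complex.I * (L v : ℝ)))
        hg_phase (fun x _ => hg x) (fun x _ => by fun_prop)]
    simp only [fderiv_cexp_I_mul_apply, mul_assoc]
  have hnorm : |L v| * ‖dualFourier μ g L‖ = ‖dualFourier μ (fun x => fderiv ℝ g x v) L‖ := by
    rw [← norm_neg (dualFourier μ (fun x => fderiv ℝ g x v) L), ← hparts, norm_mul, norm_mul,
      Complex.norm_I, one_mul, Complex.norm_real, Real.norm_eq_abs, mul_comm]
  rw [hnorm]
  refine (norm_integral_le_integral_norm _).trans_eq ?_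
  simp only [norm_mul, Complex.norm_exp_I_mul_ofReal, mul_one]

lemma norm_dualFourier_le_div [FiniteDimensional ℝ X] [μ.IsAddHaarMeasure] {g : X → ℂ}
    (hg : Differentiable ℝ g) (hg_int : Integrable g μ)
    (hg_norm : Integrable (fun x => ‖x‖ * ‖g x‖) μ) (hg_mean : ∫ x, g x ∂μ = 0) {v : X}
    (hg_fderiv : Integrable (fun x => fderiv ℝ g x v) μ) {M : ℝ} {L : X →L[ℝ] ℝ}
    (hL : ‖L‖ ≤ M * |L v|) :
    ‖dualFourier μ g L‖ ≤ (M * (∫ x, ‖x‖ * ‖g x‖ ∂μ) + ∫ x, ‖fderiv ℝ g x v‖ ∂μ)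
      * |L v| / (1 + |L v| ^ 2) := by
  have hmean := norm_dualFourier_le_of_integral_eq_zero hg_int hg_norm hg_mean L
  have hparts := abs_apply_mul_norm_dualFourier_le hg hg_int hg_fderiv L
  rw [le_div_iff₀ (by positivity)]
  calc ‖dualFourier μ g L‖ * (1 + |L v| ^ 2)
      = ‖dualFourier μ g L‖ + |L v| * ‖dualFourier μ g L‖ * |L v| := by ring
    _ ≤ M * |L v| * (∫ x, ‖x‖ * ‖g x‖ ∂μ) + (∫ x, ‖fderiv ℝ g x v‖ ∂μ) * |L v| := by
        gcongr
        exact hmean.trans (by gcongr)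
    _ = _ := by ring

lemma integrable_fderiv_apply_of_hasCompactSupport [IsFiniteMeasureOnCompacts μ] {g : X → ℂ}
    (hg : ContDiff ℝ 1 g) (hg_supp : HasCompactSupport g) (v : X) :
    Integrable (fun x => fderiv ℝ g x v) μ :=
  ((hg.continuous_fderiv one_ne_zero).clm_apply continuous_const).integrable_of_hasCompactSupport
    (hg_supp.fderiv_apply ℝ v)

end DualFourier

section LightCone

variable {E : Type*} [NormedAddCommGroup E] [InnerProductSpace ℝ E]

/-- The covector `(t, 𝐱) ↦ p · 𝐱 - |p| t`, the phase of a positive-frequency massless plane wave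
of momentum `p`. -/
noncomputable def lightConeCovector (p : E) : ℝ × E →L[ℝ] ℝ :=
  (innerSL ℝ p).comp (ContinuousLinearMap.snd ℝ ℝ E) - ‖p‖ • ContinuousLinearMap.fst ℝ ℝ E

@[simp]
lemma lightConeCovector_apply (p : E) (x : ℝ × E) :
    lightConeCovector p x = inner ℝ p x.2 - ‖p‖ * x.1 := rfl

@[fun_prop]
lemma continuous_lightConeCovector : Continuous (lightConeCovector : E → ℝ × E →L[ℝ] ℝ) := by
  unfold lightConeCovector
  fun_prop

lemma norm_lightConeCovector_le (p : E) : ‖lightConeCovector p‖ ≤ 2 * ‖p‖ := by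
  refine ContinuousLinearMap.opNorm_le_bound _ (by positivity) fun x => ?_
  calc ‖lightConeCovector p x‖ ≤ ‖(inner ℝ p x.2 : ℝ)‖ + ‖‖p‖ * x.1‖ := norm_sub_le _ _
    _ ≤ ‖p‖ * ‖x‖ + ‖p‖ * ‖x‖ := by
        rw [norm_mul, norm_norm]
        gcongr
        · exact (norm_inner_le_norm p x.2).trans (by gcongr; exact norm_snd_le x)
        · exact norm_fst_le x
    _ = 2 * ‖p‖ * ‖x‖ := by ring

/-- The plane wave `e^{-|p|(ε + it)} (1 + |p|(ε + it)) e^{i p · 𝐱} / (4|p|³)`: the integrand of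
`smearedKernel` with the time difference `t` displaced to `t - iε`. -/
noncomputable def regularizedKernel (ε : ℝ) (p : E) (x : ℝ × E) : ℂ :=
  masslessKernel (ε + Complex.I * x.1) ‖p‖ * Complex.exp (Complex.I * (inner ℝ p x.2 : ℝ))

@[fun_prop]
lemma continuous_regularizedKernel (ε : ℝ) (p : E) : Continuous (regularizedKernel ε p) := by
  unfold regularizedKernel masslessKernel
  fun_prop

lemma regularizedKernel_sub_eq (ε : ℝ) (p : E) (x y : ℝ × E) :
    regularizedKernel ε p (x - y) = Real.exp (-(ε * ‖p‖)) / (4 * (‖p‖ : ℂ) ^ 3) *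
      ((1 + ε * ‖p‖ : ℝ) + Complex.I * ‖p‖ * (x.1 - y.1)) *
      (Complex.exp (Complex.I * (lightConeCovector p x : ℝ)) *
        Complex.exp (Complex.I * ((-lightConeCovector p) y : ℝ))) := by
  have hexp : Complex.exp (-((ε + Complex.I * (x.1 - y.1 : ℝ)) * ‖p‖)) *
      Complex.exp (Complex.I * (inner ℝ p (x.2 - y.2) : ℝ)) = Real.exp (-(ε * ‖p‖)) *
        (Complex.exp (Complex.I * (lightConeCovector p x : ℝ)) *
          Complex.exp (Complex.I * ((-lightConeCovector p) y : ℝ))) := by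
    rw [Complex.ofReal_exp, ← Complex.exp_add, ← Complex.exp_add, ← Complex.exp_add,
      inner_sub_right]
    congr 1
    simp only [neg_apply, lightConeCovector_apply]
    push_cast
    ring
  rw [regularizedKernel, masslessKernel, Prod.fst_sub, Prod.snd_sub, div_mul_eq_mul_div,
    mul_right_comm, hexp]
  push_cast
  ring

section Smearing

variable [FiniteDimensional ℝ E] [MeasurableSpace E] [BorelSpace E]

/-- The regularized kernel at momentum `p` paired with the two-point test function `F`. -/
noncomputable def smearedRegularizedKernel (F : (ℝ × E) × (ℝ × E) → ℂ) (ε : ℝ) (p : E) : ℂ :=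
  ∫ z, F z * regularizedKernel ε p (z.1 - z.2)

lemma smearedRegularizedKernel_tensor {f g : ℝ × E → ℂ} (hf : Integrable f) (hg : Integrable g)
    (htf : Integrable fun x => x.1 * f x) (htg : Integrable fun x => x.1 * g x) (ε : ℝ) (p : E) :
    smearedRegularizedKernel (fun z => f z.1 * g z.2) ε p
      = Real.exp (-(ε * ‖p‖)) / (4 * (‖p‖ : ℂ) ^ 3) *
        ((1 + ε * ‖p‖ : ℝ) * (dualFourier volume f (lightConeCovector p) *
            dualFourier volume g (-lightConeCovector p)) +
          Complex.I * ‖p‖ *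
            (dualFourier volume (fun x => x.1 * f x) (lightConeCovector p) *
                dualFourier volume g (-lightConeCovector p)
              - dualFourier volume f (lightConeCovector p) *
                dualFourier volume (fun x => x.1 * g x) (-lightConeCovector p))) := by
  have hprod {u v : ℝ × E → ℂ} (hu : Integrable u) (hv : Integrable v) :=
    (integrable_mul_cexp_I_mul hu (lightConeCovector p)).mul_prod
      (integrable_mul_cexp_I_mul hv (-lightConeCovector p))
  simp only [dualFourier]
  rw [← integral_prod_mul, ← integral_prod_mul, ← integral_prod_mul,
    ← integral_sub (hprod htf hg) (hprod hf htg), ← integral_const_mul, ← integral_const_mul,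
    ← integral_add ((hprod hf hg).const_mul _) (((hprod htf hg).sub' (hprod hf htg)).const_mul _),
    ← integral_const_mul, smearedRegularizedKernel, Measure.volume_eq_prod]
  congr 1 with z
  rw [regularizedKernel_sub_eq]
  ring

lemma norm_one_add_mul_add_I_mul_sub_le {ε q : ℝ} (A B A' B' : ℂ) (hε : 0 ≤ ε) (hq : 0 ≤ q) :
    ‖((1 + ε * q : ℝ) * (A * B) + Complex.I * q * (A' * B - A * B') : ℂ)‖
      ≤ (1 + ε * q) * (‖A‖ * ‖B‖) + (q * ‖A'‖ * ‖B‖ + q * ‖B'‖ * ‖A‖) := by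
  refine (norm_add_le _ _).trans (add_le_add ?_ ?_)
  · rw [norm_mul, norm_mul, Complex.norm_real, Real.norm_of_nonneg (by positivity)]
  · rw [norm_mul, norm_mul, Complex.norm_I, one_mul, Complex.norm_real, Real.norm_of_nonneg hq]
    calc q * ‖A' * B - A * B'‖ ≤ q * (‖A'‖ * ‖B‖ + ‖A‖ * ‖B'‖) := by
          rw [← norm_mul, ← norm_mul]
          gcongr
          exact norm_sub_le _ _
      _ = _ := by ring

lemma norm_damped_combination_le {K ε q : ℝ} {A B A' B' : ℂ} (hε : 0 ≤ ε) (hq : 0 < q)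
    (hA : ‖A‖ ≤ K * q / (1 + q ^ 2)) (hB : ‖B‖ ≤ K * q / (1 + q ^ 2))
    (hA' : q * ‖A'‖ ≤ K) (hB' : q * ‖B'‖ ≤ K) :
    ‖(Real.exp (-(ε * q)) / (4 * (q : ℂ) ^ 3) *
        ((1 + ε * q : ℝ) * (A * B) + Complex.I * q * (A' * B - A * B')) : ℂ)‖
      ≤ K ^ 2 * ((1 + q ^ 2)⁻¹ / q ^ 2) := by
  have hK : 0 ≤ K := (by positivity : 0 ≤ q * ‖A'‖).trans hA'
  have hexp : Real.exp (-(ε * q)) * (1 + ε * q) ≤ 1 := by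
    rw [Real.exp_neg, inv_mul_le_iff₀ (Real.exp_pos _), mul_one, add_comm]
    exact Real.add_one_le_exp _
  have hexp_one : Real.exp (-(ε * q)) ≤ 1 := Real.exp_le_one_iff.2 (neg_nonpos.2 (by positivity))
  have hAB : ‖A‖ * ‖B‖ ≤ K ^ 2 * q / (1 + q ^ 2) := by
    calc ‖A‖ * ‖B‖ ≤ (K * q / (1 + q ^ 2)) * (K * q / (1 + q ^ 2)) := by gcongr
      _ = K ^ 2 * q / (1 + q ^ 2) * (q / (1 + q ^ 2)) := by ring
      _ ≤ K ^ 2 * q / (1 + q ^ 2) := mul_le_of_le_one_right (by positivity)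
        ((div_le_one (by positivity)).2 (by nlinarith [sq_nonneg (q - 1)]))
  have hcross {u v : ℝ} (hu : q * u ≤ K) (hv : 0 ≤ v) (hv' : v ≤ K * q / (1 + q ^ 2)) :
      q * u * v ≤ K ^ 2 * q / (1 + q ^ 2) := by
    calc q * u * v ≤ K * (K * q / (1 + q ^ 2)) := by gcongr
      _ = K ^ 2 * q / (1 + q ^ 2) := by ring
  rw [norm_mul, norm_div, norm_mul, norm_pow, Complex.norm_real, Complex.norm_real,
    Real.norm_of_nonneg (Real.exp_pos _).le, Real.norm_of_nonneg hq.le, Complex.norm_ofNat,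
    div_mul_eq_mul_div]
  calc Real.exp (-(ε * q)) * ‖_‖ / (4 * q ^ 3)
      ≤ Real.exp (-(ε * q)) * ((1 + ε * q) * (‖A‖ * ‖B‖) +
          (q * ‖A'‖ * ‖B‖ + q * ‖B'‖ * ‖A‖)) / (4 * q ^ 3) := by
        gcongr
        exact norm_one_add_mul_add_I_mul_sub_le A B A' B' hε hq.le
    _ = (Real.exp (-(ε * q)) * (1 + ε * q) * (‖A‖ * ‖B‖) +
          Real.exp (-(ε * q)) * (q * ‖A'‖ * ‖B‖ + q * ‖B'‖ * ‖A‖)) / (4 * q ^ 3) := by ring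
    _ ≤ (1 * (K ^ 2 * q / (1 + q ^ 2)) +
          1 * (K ^ 2 * q / (1 + q ^ 2) + K ^ 2 * q / (1 + q ^ 2))) / (4 * q ^ 3) := by
        gcongr
        · exact hcross hA' (norm_nonneg B) hB
        · exact hcross hB' (norm_nonneg A) hA
    _ = 3 / 4 * (K ^ 2 * ((1 + q ^ 2)⁻¹ / q ^ 2)) := by field_simp; ring
    _ ≤ K ^ 2 * ((1 + q ^ 2)⁻¹ / q ^ 2) := mul_le_of_le_one_left (by positivity) (by norm_num)

lemma exists_norm_mul_norm_dualFourier_lightConeCovector_le {g : ℝ × E → ℂ}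
    (hg : ContDiff ℝ 1 g) (hg_supp : HasCompactSupport g) :
    ∃ C, ∀ p : E, ‖p‖ * ‖dualFourier volume g (lightConeCovector p)‖ ≤ C ∧
      ‖p‖ * ‖dualFourier volume g (-lightConeCovector p)‖ ≤ C := by
  have hhaar : (volume : Measure (ℝ × E)).IsAddHaarMeasure :=
    Measure.prod.instIsAddHaarMeasure _ _
  have hbound := abs_apply_mul_norm_dualFourier_le (hg.differentiable one_ne_zero)
    (hg.continuous.integrable_of_hasCompactSupport hg_supp)
    (integrable_fderiv_apply_of_hasCompactSupport (μ := volume) hg hg_supp (1, 0))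
  exact ⟨_, fun p => ⟨by simpa using hbound (lightConeCovector p),
    by simpa using hbound (-lightConeCovector p)⟩⟩

lemma exists_norm_dualFourier_lightConeCovector_le_div {f : ℝ × E → ℂ} (hf : ContDiff ℝ 1 f)
    (hf_supp : HasCompactSupport f) (hf_mean : ∫ x, f x = 0) :
    ∃ C, ∀ p : E, ‖dualFourier volume f (lightConeCovector p)‖ ≤ C * ‖p‖ / (1 + ‖p‖ ^ 2) ∧
      ‖dualFourier volume f (-lightConeCovector p)‖ ≤ C * ‖p‖ / (1 + ‖p‖ ^ 2) := by
  have hhaar : (volume : Measure (ℝ × E)).IsAddHaarMeasure :=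
    Measure.prod.instIsAddHaarMeasure _ _
  have hnorm : Integrable fun x => ‖x‖ * ‖f x‖ :=
    (continuous_norm.mul hf.continuous.norm).integrable_of_hasCompactSupport hf_supp.norm.mul_left
  have hbound (L : ℝ × E →L[ℝ] ℝ) (hL : ‖L‖ ≤ 2 * |L (1, 0)|) :=
    norm_dualFourier_le_div (hf.differentiable one_ne_zero)
      (hf.continuous.integrable_of_hasCompactSupport hf_supp) hnorm hf_mean
      (integrable_fderiv_apply_of_hasCompactSupport hf hf_supp (1, 0)) hL
  have hL (p : E) : ‖lightConeCovector p‖ ≤ 2 * |lightConeCovector p (1, 0)| := by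
    simpa using norm_lightConeCovector_le p
  have hL_neg (p : E) : ‖-lightConeCovector p‖ ≤ 2 * |(-lightConeCovector p) (1, 0)| :=
    (ContinuousLinearMap.opNorm_neg (lightConeCovector p)).trans_le (by simpa using hL p)
  exact ⟨_, fun p => ⟨by simpa using hbound (lightConeCovector p) (hL p),
    by simpa using hbound (-lightConeCovector p) (hL_neg p)⟩⟩

variable {f : ℝ × E → ℂ}

lemma integrable_fst_mul_of_hasCompactSupport (hf : Continuous f) (hf_supp : HasCompactSupport f) :
    Integrable fun x => x.1 * f x :=
  Continuous.integrable_of_hasCompactSupport (by fun_prop) hf_supp.mul_left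

lemma exists_norm_smearedRegularizedKernel_tensor_le (hf : ContDiff ℝ 1 f)
    (hf_supp : HasCompactSupport f) (hf_mean : ∫ x, f x = 0) :
    ∃ C, ∀ ε, 0 ≤ ε → ∀ p : E, ‖smearedRegularizedKernel (fun z => f z.1 * f z.2) ε p‖
      ≤ C * ((1 + ‖p‖ ^ 2)⁻¹ / ‖p‖ ^ 2) := by
  have htf : ContDiff ℝ 1 fun x : ℝ × E => (x.1 : ℂ) * f x :=
    (Complex.ofRealCLM.contDiff.comp contDiff_fst).mul hf
  have htf_supp : HasCompactSupport fun x : ℝ × E => (x.1 : ℂ) * f x := hf_supp.mul_left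
  obtain ⟨C, hC⟩ := exists_norm_dualFourier_lightConeCovector_le_div hf hf_supp hf_mean
  obtain ⟨D, hD⟩ := exists_norm_mul_norm_dualFourier_lightConeCovector_le htf htf_supp
  have hf_int := hf.continuous.integrable_of_hasCompactSupport (μ := volume) hf_supp
  have htf_int := integrable_fst_mul_of_hasCompactSupport hf.continuous hf_supp
  refine ⟨max C D ^ 2, fun ε hε p => ?_⟩
  rcases eq_or_ne p 0 with rfl | hp
  · simp [smearedRegularizedKernel, regularizedKernel, masslessKernel]
  have hle : C * ‖p‖ / (1 + ‖p‖ ^ 2) ≤ max C D * ‖p‖ / (1 + ‖p‖ ^ 2) := by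
    gcongr
    exact le_max_left C D
  rw [smearedRegularizedKernel_tensor hf_int hf_int htf_int htf_int]
  exact norm_damped_combination_le hε (norm_pos_iff.2 hp) ((hC p).1.trans hle)
    ((hC p).2.trans hle) ((hD p).1.trans (le_max_right C D)) ((hD p).2.trans (le_max_right C D))

lemma integrable_inv_one_add_sq_div_norm_sq (hE : finrank ℝ E = 3) :
    Integrable fun p : E => (1 + ‖p‖ ^ 2)⁻¹ / ‖p‖ ^ 2 :=
  integrable_div_norm_sq_of_finrank_eq_three (g := fun q => (1 + q ^ 2)⁻¹) hE
    integrable_inv_one_add_sq.integrableOn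

lemma hasCompactSupport_fst_mul_snd {X Y : Type*} [TopologicalSpace X] [TopologicalSpace Y]
    {f : X → ℂ} {g : Y → ℂ} (hf : HasCompactSupport f) (hg : HasCompactSupport g) :
    HasCompactSupport fun z : X × Y => f z.1 * g z.2 := by
  refine HasCompactSupport.intro' (hf.isCompact.prod hg.isCompact)
    ((isClosed_tsupport f).prod (isClosed_tsupport g)) fun z hz => ?_
  rw [mem_prod, not_and_or] at hz
  rcases hz with hz | hz <;> simp [image_eq_zero_of_notMem_tsupport hz]

lemma continuous_smearedRegularizedKernel_tensor (hf : Integrable f)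
    (htf : Integrable fun x => x.1 * f x) (p : E) :
    Continuous fun ε => smearedRegularizedKernel (fun z => f z.1 * f z.2) ε p := by
  simp_rw [smearedRegularizedKernel_tensor hf hf htf htf]
  fun_prop

lemma measurable_smearedRegularizedKernel_tensor (hf : Integrable f)
    (htf : Integrable fun x => x.1 * f x) (ε : ℝ) :
    Measurable fun p : E => smearedRegularizedKernel (fun z => f z.1 * f z.2) ε p := by
  have hf_meas := (continuous_dualFourier hf).measurable
  have htf_meas := (continuous_dualFourier htf).measurable
  simp_rw [smearedRegularizedKernel_tensor hf hf htf htf]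
  fun_prop

lemma integrable_smearedRegularizedKernel_tensor (hE : finrank ℝ E = 3) (hf : ContDiff ℝ 1 f)
    (hf_supp : HasCompactSupport f) (hf_mean : ∫ x, f x = 0) {ε : ℝ} (hε : 0 ≤ ε) :
    Integrable fun p : E => smearedRegularizedKernel (fun z => f z.1 * f z.2) ε p := by
  obtain ⟨C, hC⟩ := exists_norm_smearedRegularizedKernel_tensor_le hf hf_supp hf_mean
  exact ((integrable_inv_one_add_sq_div_norm_sq hE).const_mul C).mono'
    (measurable_smearedRegularizedKernel_tensor
      (hf.continuous.integrable_of_hasCompactSupport hf_supp)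
      (integrable_fst_mul_of_hasCompactSupport hf.continuous hf_supp) ε).aestronglyMeasurable
    (Eventually.of_forall (hC ε hε))

lemma tendsto_integral_smearedRegularizedKernel_tensor (hE : finrank ℝ E = 3)
    (hf : ContDiff ℝ 1 f) (hf_supp : HasCompactSupport f) (hf_mean : ∫ x, f x = 0) :
    Tendsto (fun ε => ∫ p : E, smearedRegularizedKernel (fun z => f z.1 * f z.2) ε p) (𝓝[>] 0)
      (𝓝 (∫ p : E, smearedRegularizedKernel (fun z => f z.1 * f z.2) 0 p)) := by
  obtain ⟨C, hC⟩ := exists_norm_smearedRegularizedKernel_tensor_le hf hf_supp hf_mean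
  have hcont := continuous_smearedRegularizedKernel_tensor
    (hf.continuous.integrable_of_hasCompactSupport hf_supp)
    (integrable_fst_mul_of_hasCompactSupport hf.continuous hf_supp)
  refine tendsto_integral_filter_of_dominated_convergence _ ?_ ?_
    ((integrable_inv_one_add_sq_div_norm_sq hE).const_mul C)
    (Eventually.of_forall fun p => ((hcont p).tendsto 0).mono_left nhdsWithin_le_nhds)
  · filter_upwards [self_mem_nhdsWithin] with ε hε
    exact (integrable_smearedRegularizedKernel_tensor hE hf hf_supp hf_mean
      (mem_Ioi.1 hε).le).aestronglyMeasurable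
  · filter_upwards [self_mem_nhdsWithin] with ε hε
    exact Eventually.of_forall (hC ε (mem_Ioi.1 hε).le)

end Smearing

end LightCone

section LogSingularity

section Shear

variable {G Y : Type*} [TopologicalSpace G] [MeasurableSpace G] {μ : Measure G} [SFinite μ]
  [TopologicalSpace Y] [MeasurableSpace Y] {ν : Measure Y} [SFinite ν]

lemma locallyIntegrable_comp_fst [IsLocallyFiniteMeasure ν] {h : G → ℝ}
    (hh : LocallyIntegrable h μ) : LocallyIntegrable (fun z : G × Y => h z.1) (μ.prod ν) := by
  intro z
  obtain ⟨s, hs, hs_int⟩ := hh z.1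
  obtain ⟨t, ht, ht_fin⟩ := ν.finiteAt_nhds z.2
  have : IsFiniteMeasure (ν.restrict t) := ⟨by simpa using ht_fin⟩
  refine ⟨s ×ˢ t, prod_mem_nhds hs ht, ?_⟩
  rw [IntegrableOn, ← Measure.prod_restrict]
  exact hs_int.comp_fst _

variable [AddGroup G] [IsTopologicalAddGroup G]

/-- The shear `(x, y) ↦ (x + c y, y)` of `G × Y` along the graph of `c`. -/
def graphShear {c : Y → G} (hc : Continuous c) : G × Y ≃ₜ G × Y where
  toFun z := (z.1 + c z.2, z.2)
  invFun z := (z.1 - c z.2, z.2)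
  left_inv z := by simp
  right_inv z := by simp

variable [BorelSpace G] [SecondCountableTopology G] [μ.IsAddRightInvariant] [BorelSpace Y]

lemma measurePreserving_graphShear {c : Y → G} (hc : Continuous c) :
    MeasurePreserving (graphShear hc) (μ.prod ν) (μ.prod ν) :=
  Measure.measurePreserving_swap.comp <| (MeasurePreserving.skew_product
    (g := fun y x => x + c y) (MeasurePreserving.id ν) (by fun_prop)
    (Eventually.of_forall fun y => map_add_right_eq_self μ (c y))).comp
      Measure.measurePreserving_swap

lemma quasiMeasurePreserving_add_comp {c : Y → G} (hc : Continuous c) :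
    Measure.QuasiMeasurePreserving (fun z : G × Y => z.1 + c z.2) (μ.prod ν) μ :=
  Measure.quasiMeasurePreserving_fst.comp (measurePreserving_graphShear hc).quasiMeasurePreserving

lemma locallyIntegrable_comp_add [SecondCountableTopology Y] [IsLocallyFiniteMeasure ν]
    {h : G → ℝ} (hh : LocallyIntegrable h μ) {c : Y → G} (hc : Continuous c) :
    LocallyIntegrable (fun z : G × Y => h (z.1 + c z.2)) (μ.prod ν) := by
  have hmap := locallyIntegrable_comp_fst (ν := ν) hh
  rw [← (measurePreserving_graphShear hc).map_eq, locallyIntegrable_map_homeomorph] at hmap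
  exact hmap

end Shear

lemma locallyIntegrable_log : LocallyIntegrable Real.log := by
  refine locallyIntegrable_iff.2 fun K hK => ?_
  obtain ⟨R, hR⟩ := hK.isBounded.subset_closedBall 0
  rw [Real.closedBall_eq_Icc] at hR
  exact (((intervalIntegrable_iff' (by simp)).1
    intervalIntegral.intervalIntegrable_log').mono_set Icc_subset_uIcc).mono_set hR

lemma locallyIntegrable_abs_log_add_sq : LocallyIntegrable fun u => |Real.log u| + u ^ 2 :=
  (locallyIntegrable_log.mono Real.measurable_log.abs.aestronglyMeasurable
    (Eventually.of_forall fun u => (abs_abs (Real.log u)).le)).add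
      (continuous_pow 2).locallyIntegrable

/-- The sum of the logarithms of the regularized light-cone coordinates `ε + i(t ∓ |𝐱|)`. -/
noncomputable def regularizedLog {E : Type*} [Norm E] (ε : ℝ) (x : ℝ × E) : ℂ :=
  Complex.log (ε + Complex.I * (x.1 - ‖x.2‖ : ℝ)) +
    Complex.log (ε + Complex.I * (x.1 + ‖x.2‖ : ℝ))

lemma log_add_I_mul_re (ε v : ℝ) :
    (Complex.log (ε + Complex.I * v)).re = 1 / 2 * Real.log (ε ^ 2 + v ^ 2) := by
  rw [Complex.log_re, mul_comm, Complex.norm_add_mul_I, Real.log_sqrt (by positivity)]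
  ring

lemma log_add_I_mul_neg {ε : ℝ} (hε : 0 < ε) (v : ℝ) :
    Complex.log (ε + Complex.I * (-v : ℝ)) = conj (Complex.log (ε + Complex.I * v)) := by
  have hslit : (ε + Complex.I * v : ℂ) ∈ Complex.slitPlane := Or.inl (by simpa using hε)
  rw [← Complex.log_conj _ (Complex.slitPlane_arg_ne_pi hslit)]
  simp

lemma abs_half_mul_log_sq_add_sq_le {ε v : ℝ} (hε : 0 ≤ ε) (hε_one : ε ≤ 1) (hv : v ≠ 0) :
    |1 / 2 * Real.log (ε ^ 2 + v ^ 2)| ≤ |Real.log v| + v ^ 2 := by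
  have hv_sq : 0 < v ^ 2 := by positivity
  have hlower : 2 * Real.log v ≤ Real.log (ε ^ 2 + v ^ 2) := by
    have := Real.log_le_log hv_sq (show v ^ 2 ≤ ε ^ 2 + v ^ 2 by nlinarith)
    rwa [Real.log_pow] at this
  have hupper : Real.log (ε ^ 2 + v ^ 2) ≤ v ^ 2 := by
    have := Real.log_le_sub_one_of_pos (show 0 < ε ^ 2 + v ^ 2 by positivity)
    nlinarith
  rw [abs_le]
  constructor
  · linarith [neg_abs_le (Real.log v)]
  · linarith [abs_nonneg (Real.log v)]

lemma tendsto_half_mul_log_sq_add_sq {v : ℝ} (hv : v ≠ 0) :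
    Tendsto (fun ε : ℝ => 1 / 2 * Real.log (ε ^ 2 + v ^ 2)) (𝓝[>] 0) (𝓝 (Real.log v)) := by
  have hcont : ContinuousAt (fun ε : ℝ => 1 / 2 * Real.log (ε ^ 2 + v ^ 2)) 0 :=
    continuousAt_const.mul (ContinuousAt.log (by fun_prop) (by positivity))
  have hzero : 1 / 2 * Real.log (0 ^ 2 + v ^ 2) = Real.log v := by
    rw [zero_pow two_ne_zero, zero_add, Real.log_pow]
    push_cast
    ring
  exact hzero ▸ hcont.tendsto.mono_left nhdsWithin_le_nhds

variable {E : Type*} [NormedAddCommGroup E]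

lemma continuous_regularizedLog {ε : ℝ} (hε : 0 < ε) :
    Continuous (regularizedLog ε : ℝ × E → ℂ) := by
  unfold regularizedLog
  refine Continuous.add (Continuous.clog (by fun_prop) fun z => Or.inl ?_)
    (Continuous.clog (by fun_prop) fun z => Or.inl ?_) <;> simpa using hε

lemma regularizedLog_neg {ε : ℝ} (hε : 0 < ε) (x : ℝ × E) :
    regularizedLog ε (-x) = conj (regularizedLog ε x) := by
  rw [regularizedLog, regularizedLog, map_add, ← log_add_I_mul_neg hε, ← log_add_I_mul_neg hε,
    add_comm, Prod.fst_neg, Prod.snd_neg, norm_neg, neg_add', neg_sub', sub_neg_eq_add]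

lemma regularizedLog_re (ε : ℝ) (x : ℝ × E) :
    (regularizedLog ε x).re = 1 / 2 * Real.log (ε ^ 2 + (x.1 - ‖x.2‖) ^ 2) +
      1 / 2 * Real.log (ε ^ 2 + (x.1 + ‖x.2‖) ^ 2) := by
  rw [regularizedLog, Complex.add_re, log_add_I_mul_re, log_add_I_mul_re]

end LogSingularity

section LightConeLog

variable {E : Type*} [NormedAddCommGroup E] [InnerProductSpace ℝ E] [FiniteDimensional ℝ E]
  [MeasurableSpace E] [BorelSpace E]

lemma ae_sub_norm_ne_zero_and_add_norm_ne_zero :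
    ∀ᵐ x : ℝ × E, x.1 - ‖x.2‖ ≠ 0 ∧ x.1 + ‖x.2‖ ≠ 0 := by
  have hae {c : E → ℝ} (hc : Continuous c) : ∀ᵐ x : ℝ × E, x.1 + c x.2 ≠ 0 :=
    (quasiMeasurePreserving_add_comp hc).ae (Measure.ae_ne volume 0)
  filter_upwards [hae continuous_norm.neg, hae continuous_norm] with x hsub hadd
  exact ⟨by rwa [sub_eq_add_neg], hadd⟩

lemma locallyIntegrable_comp_add_norm {h : ℝ → ℝ} (hh : LocallyIntegrable h) :
    LocallyIntegrable fun x : ℝ × E => h (x.1 + ‖x.2‖) :=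
  locallyIntegrable_comp_add hh continuous_norm

lemma locallyIntegrable_comp_sub_norm {h : ℝ → ℝ} (hh : LocallyIntegrable h) :
    LocallyIntegrable fun x : ℝ × E => h (x.1 - ‖x.2‖) := by
  simp_rw [sub_eq_add_neg]
  exact locallyIntegrable_comp_add hh continuous_norm.neg

/-- As `Real.log` is `log |·|`, this holds on both sides of the light cone `a ^ 2 = b ^ 2`. -/
lemma log_sq_sub_sq {a b : ℝ} (hsub : a - b ≠ 0) (hadd : a + b ≠ 0) :
    Real.log (a ^ 2 - b ^ 2) = Real.log (a - b) + Real.log (a + b) := by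
  rw [sq_sub_sq, mul_comm, Real.log_mul hsub hadd]

lemma locallyIntegrable_log_sq_sub_norm_sq :
    LocallyIntegrable fun x : ℝ × E => Real.log (x.1 ^ 2 - ‖x.2‖ ^ 2) := by
  refine ((locallyIntegrable_comp_sub_norm locallyIntegrable_log).add
    (locallyIntegrable_comp_add_norm locallyIntegrable_log)).congr ?_
  filter_upwards [ae_sub_norm_ne_zero_and_add_norm_ne_zero] with x hx
  exact (log_sq_sub_sq hx.1 hx.2).symm

lemma quasiMeasurePreserving_fst_sub_snd :
    Measure.QuasiMeasurePreserving (fun z : (ℝ × E) × (ℝ × E) => z.1 - z.2) := by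
  have hhaar : (volume : Measure (ℝ × E)).IsAddHaarMeasure :=
    Measure.prod.instIsAddHaarMeasure _ _
  exact quasiMeasurePreserving_sub _ _

variable {F : (ℝ × E) × (ℝ × E) → ℂ}

lemma integrable_mul_comp_sub (hF : Continuous F) (hF_supp : HasCompactSupport F)
    {h : ℝ × E → ℝ} (hh : LocallyIntegrable h) :
    Integrable fun z => F z * (h (z.1 - z.2) : ℂ) := by
  have hhaar : (volume : Measure (ℝ × E)).IsAddHaarMeasure :=
    Measure.prod.instIsAddHaarMeasure _ _
  have hh_sub : LocallyIntegrable fun z : (ℝ × E) × (ℝ × E) => h (z.1 - z.2) := by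
    simp_rw [sub_eq_add_neg]
    exact locallyIntegrable_comp_add hh continuous_neg
  simpa only [Complex.real_smul, mul_comm] using
    hh_sub.integrable_smul_right_of_hasCompactSupport hF hF_supp

lemma tendsto_integral_mul_regularizedLog_re (hF : Continuous F) (hF_supp : HasCompactSupport F) :
    Tendsto (fun ε => ∫ z, F z * ((regularizedLog ε (z.1 - z.2)).re : ℂ)) (𝓝[>] 0)
      (𝓝 (∫ z, F z * (Real.log ((z.1 - z.2).1 ^ 2 - ‖(z.1 - z.2).2‖ ^ 2) : ℂ))) := by
  have hdom := (locallyIntegrable_comp_sub_norm locallyIntegrable_abs_log_add_sq).add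
    (locallyIntegrable_comp_add_norm (E := E) locallyIntegrable_abs_log_add_sq)
  have hne := quasiMeasurePreserving_fst_sub_snd.ae
    (ae_sub_norm_ne_zero_and_add_norm_ne_zero (E := E))
  refine tendsto_integral_filter_of_dominated_convergence _ ?_ ?_
    (integrable_mul_comp_sub hF hF_supp hdom).norm ?_
  · filter_upwards [self_mem_nhdsWithin] with ε hε
    have hre := Complex.continuous_re.comp (continuous_regularizedLog (E := E) (mem_Ioi.1 hε))
    exact (hF.mul (Complex.continuous_ofReal.comp
      (hre.comp (continuous_fst.sub continuous_snd)))).aestronglyMeasurable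
  · filter_upwards [Ioo_mem_nhdsGT (zero_lt_one' ℝ)] with ε hε
    filter_upwards [hne] with z hz
    rw [norm_mul, norm_mul, Complex.norm_real, Complex.norm_real, regularizedLog_re]
    gcongr
    refine ((abs_add_le _ _).trans (add_le_add ?_ ?_)).trans (Real.le_norm_self _)
    · exact abs_half_mul_log_sq_add_sq_le hε.1.le hε.2.le hz.1
    · exact abs_half_mul_log_sq_add_sq_le hε.1.le hε.2.le hz.2
  · filter_upwards [hne] with z hz
    simp only [regularizedLog_re]
    rw [log_sq_sub_sq hz.1 hz.2]
    exact ((Complex.continuous_ofReal.tendsto _).comp ((tendsto_half_mul_log_sq_add_sq hz.1).add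
      (tendsto_half_mul_log_sq_add_sq hz.2))).const_mul _

lemma integral_mul_eq_integral_mul_re_of_swap_eq_conj {X : Type*} [MeasurableSpace X]
    {μ : Measure X} [SFinite μ] {F k : X × X → ℂ} (hF : ∀ z, F z.swap = F z)
    (hk : ∀ z, k z.swap = conj (k z)) (hFk : Integrable (fun z => F z * k z) (μ.prod μ)) :
    ∫ z, F z * k z ∂μ.prod μ = ∫ z, F z * ((k z).re : ℂ) ∂μ.prod μ := by
  have hswap : (fun z => F z.swap * k z.swap) = fun z => F z * conj (k z) := by
    simp only [hF, hk]
  have hconj_int : Integrable (fun z => F z * conj (k z)) (μ.prod μ) := hswap ▸ hFk.swap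
  have hconj : ∫ z, F z * conj (k z) ∂μ.prod μ = ∫ z, F z * k z ∂μ.prod μ := by
    rw [← hswap]
    exact integral_prod_swap fun z => F z * k z
  have hre (z : X × X) : F z * ((k z).re : ℂ) = 1 / 2 * (F z * k z + F z * conj (k z)) := by
    rw [← mul_add, Complex.add_conj]
    push_cast
    ring
  simp_rw [hre]
  rw [integral_const_mul, integral_add hFk hconj_int, hconj]
  ring

lemma integrable_prod_mul_regularizedKernel_sub (hE : finrank ℝ E = 3) (hF : Continuous F)
    (hF_supp : HasCompactSupport F) {ε : ℝ} (hε : 0 < ε) (hε_one : ε ≤ 1) :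
    Integrable (Function.uncurry fun (p : E) z =>
      F z * (regularizedKernel ε p (z.1 - z.2) - masslessKernel 1 ‖p‖)) := by
  have hweight : Integrable fun z : (ℝ × E) × (ℝ × E) => ‖F z‖ *
      ((2 * ‖(ε + Complex.I * (z.1 - z.2).1 : ℂ)‖ + ‖(z.1 - z.2).2‖ + 2) / 4) :=
    Continuous.integrable_of_hasCompactSupport (by fun_prop) hF_supp.norm.mul_right
  have hexp := integrable_div_norm_sq_of_finrank_eq_three hE
    (integrableOn_exp_mul_Ioi (neg_lt_zero.2 hε) 0)
  refine (hexp.mul_prod hweight).mono' (Measurable.aestronglyMeasurable ?_)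
    (Eventually.of_forall fun ⟨p, z⟩ => ?_)
  · have hF_meas := hF.measurable
    unfold Function.uncurry regularizedKernel masslessKernel
    fun_prop
  · rw [Function.uncurry_apply_pair, norm_mul, mul_left_comm]
    gcongr
    refine (norm_masslessKernel_norm_mul_cexp_inner_sub_le ?_ hε_one _ _).trans_eq (mul_comm _ _)
    simp

lemma integral_smearedRegularizedKernel (hE : finrank ℝ E = 3) (hF : Continuous F)
    (hF_supp : HasCompactSupport F) (hF_mean : ∫ z, F z = 0) {ε : ℝ} (hε : 0 < ε)
    (hε_one : ε ≤ 1) :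
    ∫ p : E, smearedRegularizedKernel F ε p
      = -(Real.pi / 2) * ∫ z, F z * regularizedLog ε (z.1 - z.2) := by
  have hsub (p : E) : smearedRegularizedKernel F ε p
      = ∫ z, F z * (regularizedKernel ε p (z.1 - z.2) - masslessKernel 1 ‖p‖) := by
    simp_rw [mul_sub]
    rw [integral_sub, integral_mul_const, hF_mean, zero_mul, sub_zero, smearedRegularizedKernel]
    · exact Continuous.integrable_of_hasCompactSupport (by fun_prop) hF_supp.mul_right
    · exact Continuous.integrable_of_hasCompactSupport (by fun_prop) hF_supp.mul_right
  have hlog (x : ℝ × E) : ∫ p : E, (regularizedKernel ε p x - masslessKernel 1 ‖p‖)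
      = -(Real.pi / 2) * regularizedLog ε x := by
    simp_rw [regularizedKernel]
    rw [integral_masslessKernel_mul_cexp_inner_sub hE (by simpa using hε), regularizedLog]
    push_cast
    ring_nf
  simp_rw [hsub]
  rw [integral_integral_swap
    (integrable_prod_mul_regularizedKernel_sub hE hF hF_supp hε hε_one), ← integral_const_mul]
  congr 1 with z
  rw [integral_const_mul, hlog, mul_left_comm]

lemma integral_smearedRegularizedKernel_zero_tensor (hE : finrank ℝ E = 3) {f : ℝ × E → ℂ}
    (hf : ContDiff ℝ 1 f) (hf_supp : HasCompactSupport f) (hf_mean : ∫ x, f x = 0) :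
    ∫ p : E, smearedRegularizedKernel (fun z => f z.1 * f z.2) 0 p
      = -(Real.pi / 2) * ∫ z : (ℝ × E) × (ℝ × E), f z.1 * f z.2 *
          (Real.log ((z.1 - z.2).1 ^ 2 - ‖(z.1 - z.2).2‖ ^ 2) : ℂ) := by
  have hF : Continuous fun z : (ℝ × E) × (ℝ × E) => f z.1 * f z.2 := by fun_prop
  have hF_supp := hasCompactSupport_fst_mul_snd hf_supp hf_supp
  have hF_mean : ∫ z : (ℝ × E) × (ℝ × E), f z.1 * f z.2 = 0 := by
    rw [Measure.volume_eq_prod, integral_prod_mul, hf_mean, zero_mul]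
  refine tendsto_nhds_unique
    (tendsto_integral_smearedRegularizedKernel_tensor hE hf hf_supp hf_mean)
    (((tendsto_integral_mul_regularizedLog_re hF hF_supp).const_mul _).congr' ?_)
  filter_upwards [Ioo_mem_nhdsGT (zero_lt_one' ℝ)] with ε hε
  have hswap (z : (ℝ × E) × (ℝ × E)) :
      regularizedLog ε (z.swap.1 - z.swap.2) = conj (regularizedLog ε (z.1 - z.2)) := by
    rw [Prod.fst_swap, Prod.snd_swap, ← neg_sub, regularizedLog_neg hε.1]
  have hlog : Continuous fun z : (ℝ × E) × (ℝ × E) => regularizedLog ε (z.1 - z.2) :=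
    (continuous_regularizedLog hε.1).comp (continuous_fst.sub continuous_snd)
  rw [integral_smearedRegularizedKernel hE hF hF_supp hF_mean hε.1 hε.2.le]
  exact congrArg _ (integral_mul_eq_integral_mul_re_of_swap_eq_conj (fun z => mul_comm _ _) hswap
    ((hF.mul hlog).integrable_of_hasCompactSupport hF_supp.mul_right)).symm

end LightConeLog

lemma log_abs_minkowskiSq (x : Spacetime) :
    Real.log |minkowskiSq x| = Real.log (x.1 ^ 2 - ‖x.2‖ ^ 2) := by
  rw [Real.log_abs, ← Real.log_neg_eq_log, minkowskiSq, neg_add, neg_neg, sub_eq_add_neg]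

lemma smearedRegularizedKernel_zero_eq_smearedKernel {f : Spacetime → ℂ} (hf : Continuous f)
    (hf_supp : HasCompactSupport f) (p : EuclideanSpace ℝ (Fin 3)) :
    smearedRegularizedKernel (fun z => f z.1 * f z.2) 0 p = smearedKernel f p := by
  rw [smearedRegularizedKernel, smearedKernel, Measure.volume_eq_prod, integral_prod]
  · congr! 4 with x x'
    rw [regularizedKernel, masslessKernel, momentumKernel, Prod.fst_sub, Prod.snd_sub]
    push_cast
    ring_nf
  · exact Continuous.integrable_of_hasCompactSupport (by fun_prop)
      (hasCompactSupport_fst_mul_snd hf_supp hf_supp).mul_right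

theorem mainTheorem5_general (f : Spacetime → ℂ) (hf : ContDiff ℝ 1 f)
    (hf_supp : HasCompactSupport f) (hf_mean : ∫ x : Spacetime, f x = 0) :
    Integrable (fun p => smearedKernel f p / (2 * (Real.pi : ℂ)) ^ 3) ∧
      Integrable (fun z : Spacetime × Spacetime =>
        f z.1 * f z.2 * (Real.log |minkowskiSq (z.1 - z.2)| : ℂ)) ∧
      ∫ p, smearedKernel f p / (2 * (Real.pi : ℂ)) ^ 3 =
        -(1 / (16 * (Real.pi : ℂ) ^ 2)) * ∫ x : Spacetime, ∫ x' : Spacetime,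
          f x * f x' * (Real.log |minkowskiSq (x - x')| : ℂ) := by
  have hE : finrank ℝ (EuclideanSpace ℝ (Fin 3)) = 3 := finrank_euclideanSpace_fin
  have hF : Continuous fun z : Spacetime × Spacetime => f z.1 * f z.2 := by fun_prop
  have hlog : Integrable fun z : Spacetime × Spacetime =>
      f z.1 * f z.2 * (Real.log ((z.1 - z.2).1 ^ 2 - ‖(z.1 - z.2).2‖ ^ 2) : ℂ) :=
    integrable_mul_comp_sub hF (hasCompactSupport_fst_mul_snd hf_supp hf_supp)
      locallyIntegrable_log_sq_sub_norm_sq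
  simp only [log_abs_minkowskiSq,
    ← smearedRegularizedKernel_zero_eq_smearedKernel hf.continuous hf_supp]
  refine ⟨(integrable_smearedRegularizedKernel_tensor hE hf hf_supp hf_mean le_rfl).div_const _,
    hlog, ?_⟩
  rw [integral_div, integral_smearedRegularizedKernel_zero_tensor hE hf hf_supp hf_mean,
    Measure.volume_eq_prod, integral_prod _ hlog]
  have hpi : (Real.pi : ℂ) ≠ 0 := Complex.ofReal_ne_zero.2 Real.pi_ne_zero
  field_simp
  ring

theorem mainTheorem5 (f : Spacetime → ℂ)
    (hf_smooth : ContDiff ℝ ((⊤ : ℕ∞) : WithTop ℕ∞) f)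
    (hf_supp : HasCompactSupport f)
    (hf_mean : ∫ x : Spacetime, f x = 0) :
    MeasureTheory.Integrable
        (fun p : EuclideanSpace ℝ (Fin 3) => smearedKernel f p / (2 * (Real.pi : ℂ)) ^ 3) ∧
      MeasureTheory.Integrable
        (fun z : Spacetime × Spacetime =>
          f z.1 * f z.2 * (Real.log |minkowskiSq (z.1 - z.2)| : ℂ)) ∧
      ∫ p : EuclideanSpace ℝ (Fin 3), smearedKernel f p / (2 * (Real.pi : ℂ)) ^ 3 =
        -(1 / (16 * (Real.pi : ℂ) ^ 2)) *
          ∫ x : Spacetime, ∫ x' : Spacetime,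
            f x * f x' * (Real.log |minkowskiSq (x - x')| : ℂ) :=
  mainTheorem5_general f (hf_smooth.of_le (by exact_mod_cast le_top)) hf_supp hf_mean
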